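/- Let $p$ be a prime and write $\mathbb{Z}_p=\mathbb{Z}/p\mathbb{Z}$. For a group $G$ define the derived $p$-series by $G^{(0)}=G$ and $G^{(n+1)}=[G^{(n)},G^{(n)}]\,(G^{(n)})^p$ for $n\ge 0$, where $H^p$ denotes the subgroup generated by the $p$-th powers of the elements of $H$, and set $G^{(\omega)}=\bigcap_{n=1}^{\infty}G^{(n)}$. Every homomorphism $A\to B$ maps $A^{(n)}$ into $B^{(n)}$ and $A^{(\omega)}$ into $B^{(\omega)}$, and hence induces homomorphisms $A/A^{(n)}\to B/B^{(n)}$ and $A/A^{(\omega)}\to B/B^{(\omega)}$. Let $H_i(-;\mathbb{Z}_p)$ denote group homology with trivial coefficients. Let $A$ and $B$ be finitely generated groups and let $\phi:A\to B$ be a homomorphism. If $\phi$ induces an isomorphism (respectively, a monomorphism) $H_1(A;\mathbb{Z}_p)\to H_1(B;\mathbb{Z}_p)$ and an epimorphism $H_2(A;\mathbb{Z}_p)\to H_2(B;\mathbb{Z}_p)$, then for each finite $n\ge 0$ it induces an isomorphism (respectively, a monomorphism) $A/A^{(n)}\to B/B^{(n)}$. In either case $\phi$ also induces a monomorphism $A/A^{(\omega)}\to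 B/B^{(\omega)}$. -/

import Mathlib

universe u

open CategoryTheory

/-- The derived `p`-series of a group `G`: `G⁽⁰⁾ = G` and `G⁽ⁿ⁺¹⁾ = [G⁽ⁿ⁾, G⁽ⁿ⁾] (G⁽ⁿ⁾)ᵖ`, where
`Hᵖ` is the subgroup generated by the `p`-th powers of the elements of `H`. -/
def derivedPSeries (p : ℕ) (G : Type u) [Group G] : ℕ → Subgroup G
  | 0 => ⊤
  | n + 1 => ⁅derivedPSeries p G n, derivedPSeries p G n⁆ ⊔
      Subgroup.closure ((fun x : G => x ^ p) '' (derivedPSeries p G n : Set G))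

/-- `G⁽ω⁾`, the intersection of the terms `G⁽ⁿ⁾` with `n ≥ 1`. -/
def derivedPSeriesOmega (p : ℕ) (G : Type u) [Group G] : Subgroup G :=
  ⨅ n : ℕ, derivedPSeries p G (n + 1)

/-- A homomorphism maps `A⁽ⁿ⁾` into `B⁽ⁿ⁾`. -/
theorem derivedPSeries_le_comap (p : ℕ) {A B : Type u} [Group A] [Group B] (φ : A →* B) (n : ℕ) :
    derivedPSeries p A n ≤ (derivedPSeries p B n).comap φ := by
  induction n with
  | zero => exact fun _ _ => trivial
  | succ n ih =>
    rw [← Subgroup.map_le_iff_le_comap] at ih ⊢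
    simp only [derivedPSeries, Subgroup.map_sup, Subgroup.map_commutator, MonoidHom.map_closure]
    refine sup_le_sup (Subgroup.commutator_mono ih ih) (Subgroup.closure_mono ?_)
    rintro _ ⟨_, ⟨x, hx, rfl⟩, rfl⟩
    exact ⟨φ x, ih ⟨x, hx, rfl⟩, (map_pow φ x p).symm⟩

theorem derivedPSeriesOmega_le_comap (p : ℕ) {A B : Type u} [Group A] [Group B] (φ : A →* B) :
    derivedPSeriesOmega p A ≤ (derivedPSeriesOmega p B).comap φ := by
  intro x hx
  simp only [derivedPSeriesOmega, Subgroup.mem_comap, Subgroup.mem_iInf] at hx ⊢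
  exact fun n => derivedPSeries_le_comap p φ (n + 1) (hx n)

instance derivedPSeries_normal (p : ℕ) (G : Type u) [Group G] (n : ℕ) :
    (derivedPSeries p G n).Normal :=
  ⟨fun x hx g => by simpa using derivedPSeries_le_comap p (MulAut.conj g).toMonoidHom n hx⟩

instance derivedPSeriesOmega_normal (p : ℕ) (G : Type u) [Group G] :
    (derivedPSeriesOmega p G).Normal :=
  ⟨fun x hx g => by simpa using derivedPSeriesOmega_le_comap p (MulAut.conj g).toMonoidHom hx⟩

/-- The homomorphism `A/A⁽ⁿ⁾ → B/B⁽ⁿ⁾` induced by `φ : A → B`. -/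
def derivedPSeriesQuotientMap (p : ℕ) {A B : Type u} [Group A] [Group B] (φ : A →* B) (n : ℕ) :
    A ⧸ derivedPSeries p A n →* B ⧸ derivedPSeries p B n :=
  QuotientGroup.map _ _ φ (derivedPSeries_le_comap p φ n)

/-- The homomorphism `A/A⁽ω⁾ → B/B⁽ω⁾` induced by `φ : A → B`. -/
def derivedPSeriesOmegaQuotientMap (p : ℕ) {A B : Type u} [Group A] [Group B] (φ : A →* B) :
    A ⧸ derivedPSeriesOmega p A →* B ⧸ derivedPSeriesOmega p B :=
  QuotientGroup.map _ _ φ (derivedPSeriesOmega_le_comap p φ)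

/-- The field `ℤ/p`, placed in the universe of the groups under consideration. -/
abbrev ZModLift (p : ℕ) : Type u := ULift.{u} (ZMod p)

/-- The trivial representation of `G` on `ℤ/p`. -/
noncomputable abbrev trivialCoeff (p : ℕ) (G : Type u) [Group G] :
    Rep.{u} (ZModLift.{u} p) G :=
  Rep.trivial (ZModLift.{u} p) G (ZModLift.{u} p)

/-- `Hᵢ(G; ℤ/p)`, the group homology of `G` with trivial coefficients `ℤ/p`. -/
noncomputable abbrev modPHomology (p : ℕ) (G : Type u) [Group G] (i : ℕ) :
    ModuleCat.{u} (ZModLift.{u} p) :=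
  groupHomology (trivialCoeff p G) i

/-- The identity of `ℤ/p`, as a map from the trivial representation of `A` to the restriction
along `φ : A → B` of the trivial representation of `B`. -/
noncomputable def trivialCoeffMap (p : ℕ) {A B : Type u} [Group A] [Group B] (φ : A →* B) :
    trivialCoeff p A ⟶ Rep.res φ (trivialCoeff p B) :=
  Rep.ofHom ⟨LinearMap.id, fun _ => rfl⟩

/-- The map `Hᵢ(A; ℤ/p) → Hᵢ(B; ℤ/p)` induced by `φ : A → B` and the identity of `ℤ/p`. -/
noncomputable def modPHomologyMap (p : ℕ) {A B : Type u} [Group A] [Group B] (φ : A →* B) (i : ℕ) :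
    modPHomology p A i ⟶ modPHomology p B i :=
  groupHomology.map φ (trivialCoeffMap p φ) i

/-! The hypotheses are dualized to cochains over the field `ℤ/p`: `H₁` injective makes characters of
`A` extend to `B`, `H₁` surjective makes a character of `B` vanishing on `φ(A)` zero, and `H₂`
surjective makes a 2-cocycle on `B` trivial once its pullback is.

Injectivity: every homomorphism from `A` to a finite `p`-group `P` extends along `φ`
(`exists_extension_to_pGroup`). Induct on `|P|`, dividing by a central `ℤ/p`: the obstruction to
lifting dies because it dies on `A`, and the lift is then corrected by a character. As `A` is
finitely generated, this applies to `P = A/A⁽ⁿ⁾`, and the extension of the projection kills `B⁽ⁿ⁾`,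
so `φ⁻¹(B⁽ⁿ⁾) ≤ A⁽ⁿ⁾`. Intersecting over `n` handles `ω`.

Surjectivity: a proper image in the finite `p`-group `B/B⁽ⁿ⁾` would lie in the kernel of a nonzero
character. -/

theorem LinearMap.exists_comp_eq_of_ker_le_ker {K V W U : Type*} [Field K]
    [AddCommGroup V] [Module K V] [AddCommGroup W] [Module K W] [AddCommGroup U] [Module K U]
    (T : V →ₗ[K] W) (f : V →ₗ[K] U) (h : LinearMap.ker T ≤ LinearMap.ker f) :
    ∃ g : W →ₗ[K] U, ∀ x, g (T x) = f x := by
  obtain ⟨g, hg⟩ := LinearMap.exists_extend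
    (((LinearMap.ker T).liftQ f h) ∘ₗ T.quotKerEquivRange.symm.toLinearMap)
  refine ⟨g, fun x => ?_⟩
  have := LinearMap.congr_fun hg ⟨T x, x, rfl⟩
  simp only [LinearMap.comp_apply, Submodule.subtype_apply, LinearEquiv.coe_coe] at this
  rw [this, T.quotKerEquivRange_symm_apply_image x ⟨x, rfl⟩]
  rfl

/-! ### Mod `p` homology on chains, and its duality with cochains -/

section ModPHomology

open groupHomology Finsupp

variable {p : ℕ} {A B G : Type u} [Group A] [Group B] [Group G]

theorem chainsMap₁_trivialCoeffMap (φ : A →* B) (x : A →₀ ZModLift.{u} p) :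
    chainsMap₁ φ (trivialCoeffMap p φ) x = mapDomain φ x := by
  change mapRange.linearMap LinearMap.id (mapDomain φ x) = _
  simp

theorem chainsMap₂_trivialCoeffMap (φ : A →* B) (x : A × A →₀ ZModLift.{u} p) :
    chainsMap₂ φ (trivialCoeffMap p φ) x = mapDomain (Prod.map φ φ) x := by
  change mapRange.linearMap LinearMap.id (mapDomain (Prod.map φ φ) x) = _
  simp

/-- With trivial coefficients every 1-chain is a cycle, so no cycle hypothesis is needed. -/
theorem mapDomain_mem_boundaries₁_of_injective (φ : A →* B)
    (h : Function.Injective (modPHomologyMap p φ 1)) (x : A →₀ ZModLift.{u} p)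
    (hx : mapDomain φ x ∈ boundaries₁ (trivialCoeff p B)) :
    x ∈ boundaries₁ (trivialCoeff p A) := by
  have hc : x ∈ cycles₁ (trivialCoeff p A) := by
    rw [cycles₁_eq_top_of_isTrivial]; trivial
  refine (H1π_eq_zero_iff (A := trivialCoeff p A) ⟨x, hc⟩).1 (h ?_)
  rw [map_zero]
  unfold modPHomologyMap
  rw [H1π_comp_map_apply, H1π_eq_zero_iff]
  rw [coe_mapCycles₁, chainsMap₁_trivialCoeffMap]
  exact hx

theorem exists_mapDomain_sub_mem_boundaries₁ (φ : A →* B)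
    (h : Function.Surjective (modPHomologyMap p φ 1)) (x : B →₀ ZModLift.{u} p) :
    ∃ y : A →₀ ZModLift.{u} p, mapDomain φ y - x ∈ boundaries₁ (trivialCoeff p B) := by
  have hc : x ∈ cycles₁ (trivialCoeff p B) := by
    rw [cycles₁_eq_top_of_isTrivial]; trivial
  obtain ⟨y, hy⟩ := h (H1π _ ⟨x, hc⟩)
  induction y using H1_induction_on with | @h y =>
  unfold modPHomologyMap at hy
  rw [H1π_comp_map_apply, H1π_eq_iff, coe_mapCycles₁, chainsMap₁_trivialCoeffMap] at hy
  exact ⟨y.1, hy⟩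

theorem exists_mapDomain_sub_mem_boundaries₂ (φ : A →* B)
    (h : Function.Surjective (modPHomologyMap p φ 2)) (x : B × B →₀ ZModLift.{u} p)
    (hx : x ∈ cycles₂ (trivialCoeff p B)) :
    ∃ y : A × A →₀ ZModLift.{u} p, y ∈ cycles₂ (trivialCoeff p A) ∧
      mapDomain (Prod.map φ φ) y - x ∈ boundaries₂ (trivialCoeff p B) := by
  obtain ⟨y, hy⟩ := h (H2π _ ⟨x, hx⟩)
  induction y using H2_induction_on with | @h y =>
  unfold modPHomologyMap at hy
  rw [H2π_comp_map_apply, H2π_eq_iff, coe_mapCycles₂, chainsMap₂_trivialCoeffMap] at hy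
  exact ⟨y.1, y.2, hy⟩

/-- The linear functional on chains with coefficients `ℤ/p` determined by a cochain. -/
noncomputable def cochainPairing (p : ℕ) {X : Type u} (f : X → ZModLift.{u} p) :
    (X →₀ ZModLift.{u} p) →ₗ[ZModLift.{u} p] ZModLift.{u} p :=
  Finsupp.linearCombination _ f

theorem cochainPairing_single {X : Type u} (f : X → ZModLift.{u} p) (x : X)
    (c : ZModLift.{u} p) : cochainPairing p f (single x c) = c * f x := by
  simp [cochainPairing]

theorem cochainPairing_mapDomain {X Y : Type u} (f : Y → ZModLift.{u} p) (φ : X → Y)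
    (x : X →₀ ZModLift.{u} p) :
    cochainPairing p f (mapDomain φ x) = cochainPairing p (f ∘ φ) x := by
  simp [cochainPairing, linearCombination_mapDomain]

theorem cochainPairing_d₂₁ (f : G → ZModLift.{u} p) (x : G × G →₀ ZModLift.{u} p) :
    cochainPairing p f (d₂₁ (trivialCoeff p G) x) =
      cochainPairing p (fun y => f y.2 - f (y.1 * y.2) + f y.1) x := by
  induction x using Finsupp.induction_linear with
  | zero => simp
  | add x y hx hy => simp only [map_add, hx, hy]
  | single y c =>
    rw [d₂₁_single]
    rw [map_add, map_sub]
    erw [cochainPairing_single, cochainPairing_single, cochainPairing_single,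
      cochainPairing_single]
    simp only [Representation.trivial]
    simp
    ring

theorem cochainPairing_d₃₂ (z : G × G → ZModLift.{u} p)
    (hz : ∀ a b c, z (a, b) + z (a * b, c) = z (b, c) + z (a, b * c))
    (x : G × G × G →₀ ZModLift.{u} p) :
    cochainPairing p z (d₃₂ (trivialCoeff p G) x) = 0 := by
  induction x using Finsupp.induction_linear with
  | zero => simp
  | add x y hx hy => simp only [map_add, hx, hy, add_zero]
  | single y c =>
    rw [d₃₂_single]
    rw [map_sub, map_add, map_sub]
    erw [cochainPairing_single, cochainPairing_single, cochainPairing_single,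
      cochainPairing_single]
    have := hz y.1 y.2.1 y.2.2
    simp
    linear_combination - c * this

variable [Fact p.Prime]

/-- If `H₁(φ; ℤ/p)` is injective, then additive characters of `A` with values in `ℤ/p` extend
along `φ`. -/
theorem exists_extension_of_injective_homology_one (φ : A →* B)
    (h : Function.Injective (modPHomologyMap p φ 1)) (f : A → ZModLift.{u} p)
    (hf : ∀ x y, f (x * y) = f x + f y) :
    ∃ g : B → ZModLift.{u} p, (∀ x y, g (x * y) = g x + g y) ∧ ∀ a, g (φ a) = f a := by
  obtain ⟨M, hM⟩ := LinearMap.exists_comp_eq_of_ker_le_ker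
    ((boundaries₁ (trivialCoeff p B)).mkQ ∘ₗ Finsupp.lmapDomain (ZModLift.{u} p) _ φ)
    (cochainPairing p f) (by
      intro x hx
      rw [LinearMap.mem_ker, LinearMap.comp_apply, Submodule.mkQ_apply,
        Submodule.Quotient.mk_eq_zero] at hx
      obtain ⟨y, hy⟩ := mapDomain_mem_boundaries₁_of_injective φ h x hx
      rw [LinearMap.mem_ker, ← hy]
      refine (cochainPairing_d₂₁ f y).trans ?_
      have : (fun y : A × A => f y.2 - f (y.1 * y.2) + f y.1) = 0 := by
        funext y; simp [hf]
      rw [this]; simp [cochainPairing])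
  refine ⟨fun b => M ((boundaries₁ (trivialCoeff p B)).mkQ (single b 1)), fun x y => ?_,
    fun a => ?_⟩
  · rw [← map_add, ← map_add]
    refine congrArg M ((Submodule.Quotient.eq _).2 ?_)
    -- The boundary of `[x|y]` is `[y] - [xy] + [x]`, the negative of what is needed.
    refine ⟨single (x, y) (-1), ?_⟩
    refine (d₂₁_single _ _).trans ?_
    simp [Representation.trivial]
    abel
  · have := hM (single a 1)
    rw [cochainPairing_single, one_mul] at this
    rw [← this]
    simp

/-- If `H₁(φ; ℤ/p)` is surjective, then an additive character of `B` with values in `ℤ/p` that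
vanishes on the image of `φ` is zero. -/
theorem eq_zero_of_surjective_homology_one (φ : A →* B)
    (h : Function.Surjective (modPHomologyMap p φ 1)) (f : B → ZModLift.{u} p)
    (hf : ∀ x y, f (x * y) = f x + f y) (hφ : ∀ a, f (φ a) = 0) (b : B) : f b = 0 := by
  obtain ⟨y, z, hz⟩ := exists_mapDomain_sub_mem_boundaries₁ φ h (single b 1)
  have h₁ := cochainPairing_d₂₁ f z
  have h₂ : (fun y : B × B => f y.2 - f (y.1 * y.2) + f y.1) = 0 := by
    funext y; simp [hf]
  have h₃ : f ∘ φ = 0 := funext hφ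
  erw [hz] at h₁
  rw [h₂, map_sub, cochainPairing_mapDomain, cochainPairing_single, h₃] at h₁
  simpa [cochainPairing] using h₁

/-- If `H₂(φ; ℤ/p)` is surjective, then a 2-cocycle on `B` with values in `ℤ/p` whose pullback to
`A` is a coboundary is itself a coboundary. -/
theorem exists_coboundary_of_surjective_homology_two (φ : A →* B)
    (h : Function.Surjective (modPHomologyMap p φ 2)) (z : B × B → ZModLift.{u} p)
    (hz : ∀ a b c, z (a, b) + z (a * b, c) = z (b, c) + z (a, b * c))
    (f : A → ZModLift.{u} p) (hf : ∀ a b, z (φ a, φ b) = f b - f (a * b) + f a) :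
    ∃ g : B → ZModLift.{u} p, ∀ a b, z (a, b) = g b - g (a * b) + g a := by
  -- `z` factors through `d₂₁` once it kills 2-cycles. Modulo boundaries, which `z` kills, each
  -- comes from a 2-cycle on `A`, where `z` pulls back to a coboundary.
  obtain ⟨M, hM⟩ := LinearMap.exists_comp_eq_of_ker_le_ker
    (d₂₁ (trivialCoeff p B)).hom (cochainPairing p z) (by
      intro x hx
      obtain ⟨y, hy, w, hw⟩ := exists_mapDomain_sub_mem_boundaries₂ φ h x hx
      have h₁ := cochainPairing_d₃₂ z hz w
      erw [hw] at h₁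
      rw [map_sub, cochainPairing_mapDomain] at h₁
      have h₂ : z ∘ Prod.map φ φ = fun y : A × A => f y.2 - f (y.1 * y.2) + f y.1 :=
        funext fun y => hf y.1 y.2
      rw [h₂, ← cochainPairing_d₂₁, (show d₂₁ (trivialCoeff p A) y = 0 from hy), map_zero,
        zero_sub, neg_eq_zero] at h₁
      exact h₁)
  refine ⟨fun b => M (single b 1), fun a b => ?_⟩
  have h₁ := hM (single (a, b) 1)
  rw [cochainPairing_single, one_mul] at h₁
  rw [← h₁, ← map_sub, ← map_add]
  congr 1
  refine (d₂₁_single _ _).trans ?_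
  simp [Representation.trivial]

end ModPHomology

/-! ### Extending homomorphisms into finite `p`-groups -/

section CentralLift

variable {p : ℕ} [Fact p.Prime] {A B : Type u} [Group A] [Group B]

/-- Lifting along a central extension with kernel `ℤ/p`: a homomorphism from `B` to the quotient
lifts compatibly with a given lift on `A`. -/
theorem exists_lift_of_central_extension {P Q : Type*} [Group P] [Group Q] (φ : A →* B)
    (h₁ : Function.Injective (modPHomologyMap p φ 1))
    (h₂ : Function.Surjective (modPHomologyMap p φ 2))
    (π : P →* Q) (hπ : Function.Surjective π)
    (ι : Multiplicative (ZModLift.{u} p) →* P) (hι : Function.Injective ι)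
    (hker : ι.range = π.ker) (hcomm : ∀ x y, ι x * y = y * ι x)
    (f : A →* P) (g : B →* Q) (hfg : ∀ a, π (f a) = g (φ a)) :
    ∃ g' : B →* P, ∀ a, g' (φ a) = f a := by
  let i : ZModLift.{u} p → P := fun x => ι (Multiplicative.ofAdd x)
  have hi_add (x y) : i (x + y) = i x * i y := by simp [i]
  have hi_comm (x y) : i x * y = y * i x := hcomm _ _
  have hi_inj : Function.Injective i := hι.comp Multiplicative.ofAdd.injective
  have hi_ker (x) : π (i x) = 1 := by
    have : i x ∈ π.ker := hker ▸ ⟨_, rfl⟩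
    exact this
  have hi_exists (x y : P) (h : π x = π y) : ∃ c, x = i c * y := by
    have : x * y⁻¹ ∈ π.ker := by simp [MonoidHom.mem_ker, h]
    rw [← hker] at this
    obtain ⟨c, hc⟩ := this
    exact ⟨c.toAdd, by simp [i, hc]⟩
  -- `s` is a set-theoretic lift of `g`, `z` its failure to be multiplicative, and `e` the
  -- discrepancy between `f` and `s ∘ φ`.
  choose s hs using fun b => hπ (g b)
  choose z hz using fun b c => hi_exists (s b * s c) (s (b * c)) (by simp [hs])
  choose e he using fun a => hi_exists (f a) (s (φ a)) (by rw [hfg, hs])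
  have hcocycle (a b c) : z a b + z (a * b) c = z b c + z a (b * c) := by
    apply hi_inj
    apply mul_right_cancel (b := s (a * b * c))
    rw [hi_add, hi_add, mul_assoc, ← hz, ← mul_assoc, ← hz, mul_assoc (s a), hz b c,
      ← mul_assoc (s a), ← hi_comm, mul_assoc, hz a, mul_assoc a, mul_assoc]
  have hcob (a b) : z (φ a) (φ b) = (-e b) - (-e (a * b)) + (-e a) := by
    have : e a + e b + z (φ a) (φ b) = e (a * b) := by
      apply hi_inj
      apply mul_right_cancel (b := s (φ (a * b)))
      rw [← he, map_mul f, he a, he b, map_mul φ, hi_add, mul_assoc, ← hz, hi_add]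
      rw [mul_assoc, mul_assoc, ← mul_assoc (i (e b)), hi_comm (e b) (s (φ a)), mul_assoc]
    rw [← this]; ring
  obtain ⟨t, ht⟩ := exists_coboundary_of_surjective_homology_two φ h₂ (fun x => z x.1 x.2)
    hcocycle (fun a => -e a) hcob
  simp only at ht
  -- `b ↦ i (-t b) * s b` is already a homomorphic lift of `g`; on `A` it differs from `f` by the
  -- character `e + t ∘ φ`, whose extension `r` corrects it.
  obtain ⟨r, hr_add, hr⟩ := exists_extension_of_injective_homology_one φ h₁
    (fun a => e a + t (φ a)) (fun a b => by
      have h₃ := ht (φ a) (φ b)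
      rw [hcob] at h₃
      rw [map_mul]
      linear_combination h₃)
  refine ⟨MonoidHom.mk' (fun b => i (r b - t b) * s b) fun b c => ?_, fun a => ?_⟩
  · have : r (b * c) - t (b * c) = (r b - t b) + (r c - t c) + z b c := by
      rw [hr_add, ht]; ring
    rw [this, hi_add, mul_assoc, ← hz, hi_add]
    rw [mul_assoc, mul_assoc, ← mul_assoc (i (r c - t c)), hi_comm (r c - t c) (s b), mul_assoc]
  · simp [hr, ← he]

/-- Homomorphisms from `A` to finite `p`-groups extend along `φ`. -/
theorem exists_extension_to_pGroup (φ : A →* B)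
    (h₁ : Function.Injective (modPHomologyMap p φ 1))
    (h₂ : Function.Surjective (modPHomologyMap p φ 2))
    (n : ℕ) : ∀ (P : Type u) [Group P] [Finite P], IsPGroup p P → Nat.card P = n →
    ∀ f : A →* P, ∃ g : B →* P, ∀ a, g (φ a) = f a := by
  induction n using Nat.strong_induction_on with
  | _ n ih =>
  intro P _ _ hP hn f
  rcases subsingleton_or_nontrivial P with hS | hN
  · exact ⟨1, fun a => Subsingleton.elim _ _⟩
  have hp : p.Prime := Fact.out
  have := hP.center_nontrivial
  have hdvd : p ∣ Nat.card (Subgroup.center P) := by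
    obtain ⟨k, hk, hc⟩ := (hP.to_subgroup (Subgroup.center P)).nontrivial_iff_card.1 this
    exact hc ▸ dvd_pow_self p hk.ne'
  obtain ⟨x, hx⟩ := exists_prime_orderOf_dvd_card' p hdvd
  have hx' : orderOf (x : P) = p := (Subgroup.orderOf_coe x).trans hx
  have hxc (k : ℤ) (y : P) : (x : P) ^ k * y = y * (x : P) ^ k :=
    (Subgroup.mem_center_iff.1 (Subgroup.zpow_mem _ x.2 k) y).symm
  let N := Subgroup.zpowers (x : P)
  have hN : N.Normal := ⟨by
    rintro _ ⟨k, rfl⟩ g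
    refine ⟨k, ?_⟩
    simp [← hxc]⟩
  have hlt : Nat.card (P ⧸ N) < n := by
    have h₃ := Subgroup.card_eq_card_quotient_mul_card_subgroup N
    rw [Nat.card_zpowers, hx', hn] at h₃
    rw [h₃]
    have : 0 < Nat.card (P ⧸ N) := Nat.card_pos
    have := hp.two_le
    nlinarith
  obtain ⟨g, hg⟩ := ih _ hlt (P ⧸ N) (hP.to_quotient N) rfl ((QuotientGroup.mk' N).comp f)
  have hcard : Nat.card (Multiplicative (ZModLift.{u} p)) = Nat.card N := by
    rw [Nat.card_zpowers, hx', Nat.card_congr Multiplicative.toAdd,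
      Nat.card_congr Equiv.ulift, Nat.card_zmod]
  have : IsCyclic (Multiplicative (ZModLift.{u} p)) := isCyclic_of_prime_card (p := p) (by
    rw [hcard, Nat.card_zpowers, hx'])
  let e : Multiplicative (ZModLift.{u} p) ≃* N := mulEquivOfCyclicCardEq hcard
  refine exists_lift_of_central_extension φ h₁ h₂ (QuotientGroup.mk' N)
    (QuotientGroup.mk'_surjective N) (N.subtype.comp e.toMonoidHom)
    (N.subtype_injective.comp e.injective) ?_ ?_ f g fun a => (hg a).symm
  · rw [QuotientGroup.ker_mk']
    ext y
    constructor
    · rintro ⟨c, rfl⟩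
      exact (e c).2
    · intro hy
      exact ⟨e.symm ⟨y, hy⟩, by simp⟩
  · intro c y
    obtain ⟨k, hk⟩ := (e c).2
    change ((e c : N) : P) * y = y * (e c : N)
    rw [← hk]
    exact hxc k y

end CentralLift

/-! ### Quotients by the derived `p`-series are finite `p`-groups -/

section DerivedPSeries

variable (p : ℕ) {G : Type u} [Group G]

theorem commutator_le_derivedPSeries_succ (n : ℕ) :
    ⁅derivedPSeries p G n, derivedPSeries p G n⁆ ≤ derivedPSeries p G (n + 1) :=
  le_sup_left

theorem pow_mem_derivedPSeries_succ {n : ℕ} {x : G} (hx : x ∈ derivedPSeries p G n) :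
    x ^ p ∈ derivedPSeries p G (n + 1) :=
  (le_sup_right : _ ≤ derivedPSeries p G (n + 1)) (Subgroup.subset_closure ⟨x, hx, rfl⟩)

theorem derivedPSeries_succ_le (n : ℕ) :
    derivedPSeries p G (n + 1) ≤ derivedPSeries p G n := by
  refine sup_le (Subgroup.commutator_le_left _ _) ((Subgroup.closure_le _).2 ?_)
  rintro _ ⟨x, hx, rfl⟩
  exact Subgroup.pow_mem _ hx p

theorem pow_pow_mem_derivedPSeries (n : ℕ) (x : G) : x ^ p ^ n ∈ derivedPSeries p G n := by
  induction n with
  | zero => trivial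
  | succ n ih => rw [pow_succ, pow_mul]; exact pow_mem_derivedPSeries_succ p ih

theorem isPGroup_quotient_derivedPSeries (n : ℕ) : IsPGroup p (G ⧸ derivedPSeries p G n) := by
  rw [isPGroup_iff_pow_pow_eq_one]
  intro x
  induction x using QuotientGroup.induction_on with | H x =>
  refine ⟨n, ?_⟩
  rw [← QuotientGroup.mk_pow, QuotientGroup.eq_one_iff]
  exact pow_pow_mem_derivedPSeries p n x

/-- The `n`-th term of the derived `p`-series of `G/G⁽ⁿ⁾` is trivial. -/
theorem derivedPSeries_quotient_self (n : ℕ) :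
    derivedPSeries p (G ⧸ derivedPSeries p G n) n = ⊥ := by
  have key (k : ℕ) : derivedPSeries p (G ⧸ derivedPSeries p G n) k ≤
      (derivedPSeries p G k).map (QuotientGroup.mk' (derivedPSeries p G n)) := by
    induction k with
    | zero =>
      intro x _
      obtain ⟨y, rfl⟩ := QuotientGroup.mk'_surjective _ x
      exact ⟨y, trivial, rfl⟩
    | succ k ih =>
      refine sup_le ?_ ((Subgroup.closure_le _).2 ?_)
      · refine (Subgroup.commutator_mono ih ih).trans ?_
        rw [← Subgroup.map_commutator]
        exact Subgroup.map_mono (commutator_le_derivedPSeries_succ p k)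
      · rintro _ ⟨x, hx, rfl⟩
        obtain ⟨y, hy, rfl⟩ := ih hx
        exact ⟨y ^ p, pow_mem_derivedPSeries_succ p hy, map_pow _ _ _⟩
  refine le_bot_iff.1 ((key n).trans ?_)
  rw [Subgroup.map_le_iff_le_comap]
  intro x hx
  simpa using hx

theorem finiteIndex_derivedPSeries [Fact p.Prime] [Group.FG G] (n : ℕ) :
    (derivedPSeries p G n).FiniteIndex := by
  induction n with
  | zero => exact inferInstanceAs (⊤ : Subgroup G).FiniteIndex
  | succ n ih =>
    let H := derivedPSeries p G n
    let K := (derivedPSeries p G (n + 1)).subgroupOf H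
    -- Schreier: a finite-index subgroup of a finitely generated group is finitely generated. So `H
    -- ⧸ K` is finitely generated, abelian and killed by `p`, hence finite.
    have hFG : Group.FG H := inferInstance
    let _ : CommGroup (H ⧸ K) :=
      { (inferInstance : Group (H ⧸ K)) with
        mul_comm := by
          intro x y
          induction x using QuotientGroup.induction_on with | H x =>
          induction y using QuotientGroup.induction_on with | H y =>
          rw [← QuotientGroup.mk_mul, ← QuotientGroup.mk_mul, QuotientGroup.eq,
            Subgroup.mem_subgroupOf]
          have := commutator_le_derivedPSeries_succ p n
            (Subgroup.commutator_mem_commutator (H.inv_mem y.2) (H.inv_mem x.2))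
          simpa [commutatorElement_def, mul_assoc] using this }
    have hdvd := card_dvd_exponent_pow_rank' (G := H ⧸ K) (n := p) (by
      intro x
      induction x using QuotientGroup.induction_on with | H x =>
      rw [← QuotientGroup.mk_pow, QuotientGroup.eq_one_iff, Subgroup.mem_subgroupOf]
      exact pow_mem_derivedPSeries_succ p x.2)
    have hcard : Nat.card (H ⧸ K) ≠ 0 := by
      intro h0
      rw [h0, zero_dvd_iff] at hdvd
      exact pow_ne_zero _ (Fact.out : p.Prime).ne_zero hdvd
    refine ⟨?_⟩
    rw [← Subgroup.relIndex_mul_index (derivedPSeries_succ_le p n)]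
    exact mul_ne_zero hcard ih.index_ne_zero

end DerivedPSeries

/-- A proper subgroup of a finite `p`-group is contained in the kernel of a surjection
onto a group of order `p`. -/
theorem IsPGroup.exists_normal_index_eq_of_ne_top {p : ℕ} [Fact p.Prime] {Q : Type*} [Group Q]
    [Finite Q] (hQ : IsPGroup p Q) (R : Subgroup Q) (hR : R ≠ ⊤) :
    ∃ M : Subgroup Q, M.Normal ∧ R ≤ M ∧ M.index = p := by
  obtain ⟨M, hM, hRM⟩ := (eq_top_or_exists_le_coatom R).resolve_left hR
  have := hQ.isNilpotent
  have hMn : M.Normal :=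
    Subgroup.NormalizerCondition.normal_of_coatom M Group.normalizerCondition_of_isNilpotent hM
  refine ⟨M, hMn, hRM, ?_⟩
  have hpQ : IsPGroup p (Q ⧸ M) := hQ.to_quotient M
  have hdvd : p ∣ Nat.card (Q ⧸ M) := hpQ.card_eq_or_dvd.resolve_left fun h =>
    hM.1 (Subgroup.index_eq_one.1 h)
  obtain ⟨x, hx⟩ := exists_prime_orderOf_dvd_card' p hdvd
  -- By maximality of `M`, the element `x` of order `p` generates the whole quotient.
  have hle : M ≤ (Subgroup.zpowers x).comap (QuotientGroup.mk' M) := by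
    intro y hy
    rw [Subgroup.mem_comap, QuotientGroup.mk'_apply, (QuotientGroup.eq_one_iff y).2 hy]
    exact one_mem _
  rcases hM.le_iff.1 hle with h | h
  · have hz : Subgroup.zpowers x = ⊤ := by
      rw [← Subgroup.comap_top (QuotientGroup.mk' M)] at h
      exact Subgroup.comap_injective (QuotientGroup.mk'_surjective M) h
    rw [Subgroup.index, ← hx, ← Nat.card_zpowers, hz, Subgroup.card_top]
  · exfalso
    obtain ⟨y, rfl⟩ := QuotientGroup.mk'_surjective M x
    have hy : y ∈ M := h ▸ Subgroup.mem_zpowers _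
    rw [QuotientGroup.mk'_apply, (QuotientGroup.eq_one_iff y).2 hy, orderOf_one] at hx
    exact (Fact.out : p.Prime).one_lt.ne hx

/-! ### Injectivity and surjectivity on the quotients -/

section Main

variable {p : ℕ} [Fact p.Prime] {A B : Type u} [Group A] [Group B] (φ : A →* B)

theorem comap_derivedPSeries_le [Group.FG A]
    (h₁ : Function.Injective (modPHomologyMap p φ 1))
    (h₂ : Function.Surjective (modPHomologyMap p φ 2)) (n : ℕ) :
    (derivedPSeries p B n).comap φ ≤ derivedPSeries p A n := by
  intro a ha
  have := finiteIndex_derivedPSeries p (G := A) n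
  obtain ⟨g, hg⟩ := exists_extension_to_pGroup φ h₁ h₂ _ (A ⧸ derivedPSeries p A n)
    (isPGroup_quotient_derivedPSeries p n) rfl (QuotientGroup.mk' _)
  -- `g` sends `B⁽ⁿ⁾` into the `n`-th term of `A/A⁽ⁿ⁾`, which is trivial.
  have := derivedPSeries_le_comap p g n ha
  rw [derivedPSeries_quotient_self, Subgroup.mem_comap, Subgroup.mem_bot, hg] at this
  exact (QuotientGroup.eq_one_iff a).1 this

theorem derivedPSeriesQuotientMap_injective [Group.FG A]
    (h₁ : Function.Injective (modPHomologyMap p φ 1))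
    (h₂ : Function.Surjective (modPHomologyMap p φ 2)) (n : ℕ) :
    Function.Injective (derivedPSeriesQuotientMap p φ n) := by
  rw [injective_iff_map_eq_one]
  intro x hx
  induction x using QuotientGroup.induction_on with | H x =>
  rw [derivedPSeriesQuotientMap, QuotientGroup.map_mk, QuotientGroup.eq_one_iff] at hx
  exact (QuotientGroup.eq_one_iff x).2 (comap_derivedPSeries_le φ h₁ h₂ n hx)

theorem derivedPSeriesOmegaQuotientMap_injective [Group.FG A]
    (h₁ : Function.Injective (modPHomologyMap p φ 1))
    (h₂ : Function.Surjective (modPHomologyMap p φ 2)) :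
    Function.Injective (derivedPSeriesOmegaQuotientMap p φ) := by
  rw [injective_iff_map_eq_one]
  intro x hx
  induction x using QuotientGroup.induction_on with | H x =>
  rw [derivedPSeriesOmegaQuotientMap, QuotientGroup.map_mk, QuotientGroup.eq_one_iff] at hx
  simp only [derivedPSeriesOmega, Subgroup.mem_iInf] at hx
  refine (QuotientGroup.eq_one_iff x).2 ?_
  simp only [derivedPSeriesOmega, Subgroup.mem_iInf]
  exact fun n => comap_derivedPSeries_le φ h₁ h₂ (n + 1) (hx n)

theorem derivedPSeriesQuotientMap_surjective [Group.FG B]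
    (h₁ : Function.Surjective (modPHomologyMap p φ 1)) (n : ℕ) :
    Function.Surjective (derivedPSeriesQuotientMap p φ n) := by
  have := finiteIndex_derivedPSeries p (G := B) n
  rw [← MonoidHom.range_eq_top]
  by_contra hR
  obtain ⟨M, hMn, hRM, hM⟩ := (isPGroup_quotient_derivedPSeries p (G := B) n)
    |>.exists_normal_index_eq_of_ne_top _ hR
  have hcard : Nat.card (Multiplicative (ZModLift.{u} p)) = p := by
    rw [Nat.card_congr Multiplicative.toAdd, Nat.card_congr Equiv.ulift, Nat.card_zmod]
  have hc₁ : IsCyclic (Multiplicative (ZModLift.{u} p)) := isCyclic_of_prime_card hcard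
  have hc₂ : IsCyclic ((B ⧸ derivedPSeries p B n) ⧸ M) := isCyclic_of_prime_card hM
  let e : ((B ⧸ derivedPSeries p B n) ⧸ M) ≃* Multiplicative (ZModLift.{u} p) :=
    mulEquivOfCyclicCardEq (hM.trans hcard.symm)
  let q : B →* (B ⧸ derivedPSeries p B n) ⧸ M :=
    (QuotientGroup.mk' M).comp (QuotientGroup.mk' _)
  have hq (b : B) : q b = 1 := by
    -- This character vanishes on `φ(A)` because `M` contains the image, yet `q` is onto a group of
    -- order `p`.
    have := eq_zero_of_surjective_homology_one φ h₁ (fun b => (e (q b)).toAdd)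
      (fun x y => by simp) (fun a => by
        have : q (φ a) = 1 := (QuotientGroup.eq_one_iff _).2
          (hRM ⟨QuotientGroup.mk a, rfl⟩)
        simp [this]) b
    simpa using this
  have hp := (Fact.out : p.Prime).one_lt
  rw [← hM, Subgroup.index, Finite.one_lt_card_iff_nontrivial] at hp
  obtain ⟨x, hx⟩ := exists_ne (1 : (B ⧸ derivedPSeries p B n) ⧸ M)
  obtain ⟨y, rfl⟩ := QuotientGroup.mk'_surjective M x
  obtain ⟨b, rfl⟩ := QuotientGroup.mk'_surjective _ y
  exact hx (hq b)

end Main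

theorem corollary4p3 (p : ℕ) [Fact p.Prime] {A B : Type u} [Group A] [Group B]
    [Group.FG A] [Group.FG B] (φ : A →* B)
    (hH₂ : Function.Surjective (modPHomologyMap p φ 2)) :
    (Function.Bijective (modPHomologyMap p φ 1) →
      (∀ n : ℕ, Function.Bijective (derivedPSeriesQuotientMap p φ n)) ∧
        Function.Injective (derivedPSeriesOmegaQuotientMap p φ)) ∧
    (Function.Injective (modPHomologyMap p φ 1) →
      (∀ n : ℕ, Function.Injective (derivedPSeriesQuotientMap p φ n)) ∧
        Function.Injective (derivedPSeriesOmegaQuotientMap p φ)) := by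

  exact ⟨fun h => ⟨fun n => ⟨derivedPSeriesQuotientMap_injective φ h.1 hH₂ n,
      derivedPSeriesQuotientMap_surjective φ h.2 n⟩,
      derivedPSeriesOmegaQuotientMap_injective φ h.1 hH₂⟩,
    fun h => ⟨derivedPSeriesQuotientMap_injective φ h hH₂,
      derivedPSeriesOmegaQuotientMap_injective φ h hH₂⟩⟩
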